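/- Let $X$ be a Noetherian scheme and $\mathcal F$ a nonzero coherent sheaf on $X$. A point $x\in X$ is an associated point of a sheaf of $\mathcal O_X$-modules $\mathcal H$ if some $s\in\mathcal H_x$ has annihilator equal to the maximal ideal of $\mathcal O_{X,x}$; write $\operatorname{Ass}(\mathcal H)$ for the set of associated points. Order $X$ by $\mathfrak q<\mathfrak p$ if $\overline{\{\mathfrak p\}}\subsetneq\overline{\{\mathfrak q\}}$. A coprimary filtration of $\mathcal F$ consists of a total order on $\operatorname{Ass}(\mathcal F)=\{\mathfrak p_1,\dots,\mathfrak p_n\}$ extending this partial order, say $\mathfrak p_1>\mathfrak p_2>\cdots>\mathfrak p_n$, and a chain of coherent subsheaves $$0=\mathcal F^0\subseteq\mathcal F^1\subseteq\cdots\subseteq\mathcal F^n=\mathcal F$$ with $\operatorname{Ass}(\mathcal F^i/\mathcal F^{i-1})=\{\mathfrak p_i\}$ for $1\le i\le n$. Two coprimary filtrations $(\mathcal F^i)$ and $(\mathcal G^j)$ of $\mathcal F$ (possibly for different total orders) are called equivalent if $\mathcal F^{i+1}/\mathcal F^i\cong\mathcal G^{j+1}/\mathcal G^j$ whenever $\operatorname{Ass}(\mathcal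 F^{i+1}/\mathcal F^i)=\operatorname{Ass}(\mathcal G^{j+1}/\mathcal G^j)$. Theorem. Suppose that $\overline{\{\mathfrak p\}}\cap\overline{\{\mathfrak q\}}=\emptyset$ for all $\mathfrak p,\mathfrak q\in\operatorname{Ass}(\mathcal F)$ with $\mathfrak p\notin\overline{\{\mathfrak q\}}$ and $\mathfrak q\notin\overline{\{\mathfrak p\}}$. Then any two coprimary filtrations of $\mathcal F$ are equivalent. -/

import Mathlib

open CategoryTheory CategoryTheory.Limits AlgebraicGeometry

universe u

namespace CoprimaryFiltrations

variable {X : Scheme.{u}}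

/-- The stalk of an `O_X`-module at `x`, as a module over the local ring `O_{X,x}`. The scalar
multiplication is the one for which taking germs is semilinear. -/
noncomputable instance stalkModule (F : X.Modules) (x : X) :
    Module (X.presheaf.stalk x) (F.presheaf.stalk x) :=
  PresheafOfModules.instModuleCarrierStalkCommRingCatCarrierAbPresheafOpensCarrier
    (R := X.presheaf) F.val x

/-- Compatibility of the module structure on stalks with germs. -/
theorem germ_smul (F : X.Modules) (x : X) (U : X.Opens) (hx : x ∈ U)
    (r : X.presheaf.obj (.op U)) (s : F.presheaf.obj (.op U)) :
    F.presheaf.germ U x hx (r • s) =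
      X.presheaf.germ U x hx r • F.presheaf.germ U x hx s :=
  PresheafOfModules.germ_smul (R := X.presheaf) F.val x U hx r s

/-- Coherent sheaves on a locally Noetherian scheme: the quasi-coherent sheaves of finite type. -/
structure IsCoherent (F : X.Modules) : Prop where
  isQuasicoherent : F.IsQuasicoherent
  isFiniteType : SheafOfModules.IsFiniteType.{u} F

/-- The set `Ass(F)` of associated points of `F`: the points `x` such that some element of the
stalk `F_x` has the maximal ideal of `O_{X,x}` as its annihilator. -/
def associatedPoints (F : X.Modules) : Set X :=
  {x | ∃ s : F.presheaf.stalk x,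
    ∀ a : X.presheaf.stalk x, a • s = 0 ↔ a ∈ IsLocalRing.maximalIdeal (X.presheaf.stalk x)}

/-- A coprimary filtration `0 = F_0 ⊆ F_1 ⊆ ⋯ ⊆ F_n = F` of a coherent sheaf `F` on a Noetherian
scheme, together with the linear ordering `p_1 > p_2 > ⋯ > p_n` of `Ass(F)` that it belongs to.
The ordering is given as an enumeration `point` of `Ass(F)`; it extends the specialization order,
in which `q < p` when the closure of `p` is strictly contained in that of `q`. -/
structure CoprimaryFiltration (F : X.Modules) where
  /-- the number of associated points -/
  n : ℕ
  /-- the associated points, in decreasing order; `point i` is `p_{i+1}` -/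
  point : Fin n → X
  point_injective : Function.Injective point
  range_point : Set.range point = associatedPoints F
  lt_of_closure_ssubset : ∀ i j : Fin n,
    closure {point i} ⊂ closure {point j} → i < j
  /-- the subsheaves `F_0, …, F_n` -/
  sub : Fin (n + 1) → Subobject F
  sub_isCoherent : ∀ i, IsCoherent ((sub i : Subobject F) : X.Modules)
  sub_zero : sub 0 = ⊥
  sub_last : sub (Fin.last n) = ⊤
  sub_le : ∀ i : Fin n, sub i.castSucc ≤ sub i.succ
  associatedPoints_quotient : ∀ i : Fin n,
    associatedPoints (cokernel ((sub i.castSucc).ofLE (sub i.succ) (sub_le i))) = {point i}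

namespace CoprimaryFiltration

/-- The subquotient `F_{i+1} / F_i`. -/
noncomputable def subquotient {F : X.Modules} (A : CoprimaryFiltration F) (i : Fin A.n) :
    X.Modules :=
  cokernel ((A.sub i.castSucc).ofLE (A.sub i.succ) (A.sub_le i))

/-- Two coprimary filtrations are equivalent if subquotients with the same associated point are
isomorphic. -/
def Equivalent {F : X.Modules} (A B : CoprimaryFiltration F) : Prop :=
  ∀ (i : Fin A.n) (j : Fin B.n),
    associatedPoints (A.subquotient i) = associatedPoints (B.subquotient j) →
      Nonempty (A.subquotient i ≅ B.subquotient j)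

end CoprimaryFiltration

end CoprimaryFiltrations

namespace CoprimaryFiltrations

variable {X : Scheme.{u}}

/-! Suppose the subquotients `A_{i+1}/A_i` and `B_{j+1}/B_j` both have associated point `p`. Both
are isomorphic to `(A_{i+1} ⊓ B_{j+1})/(A_i ⊓ B_j)`; by symmetry it suffices to treat `A`, and the
comparison map can be tested on stalks. Off the closure of `p` both quotients have zero stalk. On
that closure, two inclusions of stalks are needed.

Both rest on one principle: a nonzero germ at `x` of a quotient with `p` as only associated point
forces `p ⤳ x` and stays nonzero at `p` (`exists_point_specializes`). A germ of `A_i ⊓ B_{j+1}`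
outside `B_j` would therefore give a nonzero germ of `A_i` at `p`, hence an earlier point of `A`
specializing to `p`, against the ordering (`stalkSubmodule_castSucc_inf_succ_le`). A germ of
`A_{i+1}` outside `B_{j+1}` would produce a later point `q` of `B`, incomparable with `p`, with `x`
in both closures, against disjointness (`stalkSubmodule_succ_le_succ`). Together they place the
stalks of `A_i` and `A_{i+1}` at `x` inside those of `B_j` and `B_{j+1}`. -/

/-! ### Exactness of stalks -/

/-- The functor taking an `O_X`-module to its stalk at `x`, as an abelian group. -/
noncomputable def stalkFunctor (x : X) : X.Modules ⥤ Ab.{u} :=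
  Scheme.Modules.toPresheaf X ⋙ TopCat.Presheaf.stalkFunctor Ab.{u} x

instance stalkFunctor_preservesFiniteLimits (x : X) : PreservesFiniteLimits (stalkFunctor x) := by
  have : PreservesFiniteLimits (TopCat.Presheaf.stalkFunctor Ab.{u} (X := X) x) := by
    have : PreservesFiniteLimits (colim (J := (TopologicalSpace.OpenNhds x)ᵒᵖ) (C := Ab.{u})) :=
      inferInstance
    have : PreservesFiniteLimits ((Functor.whiskeringLeft _ _ Ab.{u}).obj
        (TopologicalSpace.OpenNhds.inclusion x).op) :=
      ⟨fun _ _ _ ↦ inferInstance⟩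
    exact comp_preservesFiniteLimits _ _
  unfold stalkFunctor
  infer_instance

/-- Every diagram in a reflective subcategory is `L` of a diagram in `C`, so its colimit is `L` of a
colimit. -/
lemma preservesColimitsOfShape_of_reflective {C D E K : Type*} [Category* C] [Category* D]
    [Category* E] [Category* K] {L : C ⥤ D} {G : D ⥤ C} (adj : L ⊣ G) [IsIso adj.counit]
    [HasColimitsOfShape K C] (Φ : D ⥤ E) [PreservesColimitsOfShape K (L ⋙ Φ)] :
    PreservesColimitsOfShape K Φ where
  preservesColimit {F} := by
    have : L.IsLeftAdjoint := adj.isLeftAdjoint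
    let e : F ≅ (F ⋙ G) ⋙ L := Functor.isoWhiskerLeft F (asIso adj.counit).symm
    suffices PreservesColimit ((F ⋙ G) ⋙ L) Φ from preservesColimit_of_iso_diagram Φ e.symm
    exact preservesColimit_of_preserves_colimit_cocone
      (isColimitOfPreserves L (colimit.isColimit (F ⋙ G)))
      (isColimitOfPreserves (L ⋙ Φ) (colimit.isColimit (F ⋙ G)))

/-- By reflectivity it is enough to look at sheafified presheaves of modules. There the functor is
sheafification followed by the stalk, a left adjoint because of skyscraper sheaves. -/
instance stalkFunctor_preservesFiniteColimits (x : X) :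
    PreservesFiniteColimits (stalkFunctor x) where
  preservesFiniteColimits K _ _ := by
    classical
    let Ψ : ((TopologicalSpace.Opens X)ᵒᵖ ⥤ AddCommGrpCat.{u}) ⥤ AddCommGrpCat.{u} :=
      presheafToSheaf (Opens.grothendieckTopology X) AddCommGrpCat.{u} ⋙
        (TopCat.Sheaf.forget AddCommGrpCat.{u} X ⋙ TopCat.Presheaf.stalkFunctor _ x)
    let adj : Ψ ⊣ _ := (sheafificationAdjunction (Opens.grothendieckTopology X)
      AddCommGrpCat.{u}).comp (stalkSkyscraperSheafAdjunction x)
    have : PreservesColimitsOfShape K Ψ :=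
      adj.leftAdjoint_preservesColimits.preservesColimitsOfShape
    have : PreservesColimitsOfShape K
        (PresheafOfModules.sheafification (𝟙 X.ringCatSheaf.obj) ⋙ stalkFunctor x) :=
      inferInstanceAs (PreservesColimitsOfShape K
        (PresheafOfModules.toPresheaf.{u} X.ringCatSheaf.obj ⋙ Ψ))
    exact preservesColimitsOfShape_of_reflective
      (PresheafOfModules.sheafificationAdjunction (𝟙 X.ringCatSheaf.obj)) (stalkFunctor x)

lemma isIso_of_isIso_stalkFunctor_map {M N : X.Modules} (f : M ⟶ N)
    (h : ∀ x : X, IsIso ((stalkFunctor x).map f)) : IsIso f := by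
  let g : (⟨M.presheaf, M.isSheaf⟩ : TopCat.Sheaf Ab.{u} X) ⟶ ⟨N.presheaf, N.isSheaf⟩ :=
    ⟨f.mapPresheaf⟩
  have : ∀ x : X, IsIso ((TopCat.Presheaf.stalkFunctor Ab.{u} x).map g.1) := h
  have hg : IsIso g := TopCat.Presheaf.isIso_of_stalkFunctor_map_iso g
  have : IsIso ((Scheme.Modules.toPresheaf X).map f) :=
    @Functor.map_isIso _ _ _ _ _ _ (TopCat.Sheaf.forget Ab.{u} X) g hg
  exact isIso_of_reflects_iso f (Scheme.Modules.toPresheaf X)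

lemma stalkSpecializes_smul (M : X.Modules) {x y : X} (h : y ⤳ x) (a : X.presheaf.stalk x)
    (s : M.presheaf.stalk x) :
    M.presheaf.stalkSpecializes h (a • s) =
      X.presheaf.stalkSpecializes h a • M.presheaf.stalkSpecializes h s := by
  obtain ⟨U, hU, r, rfl⟩ := X.presheaf.exists_germ_eq a
  obtain ⟨V, hVU, hV, m, rfl⟩ := M.presheaf.exists_le_germ_eq s hU
  rw [← X.presheaf.germ_res_apply (homOfLE hVU) x hV r, ← germ_smul]
  simp only [TopCat.Presheaf.germ_stalkSpecializes_apply]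
  rw [germ_smul]

/-- The map on stalks at `x` induced by a morphism of `O_X`-modules, as a linear map. -/
noncomputable def stalkMap {M N : X.Modules} (f : M ⟶ N) (x : X) :
    M.presheaf.stalk x →ₗ[X.presheaf.stalk x] N.presheaf.stalk x where
  toFun s := (stalkFunctor x).map f s
  map_add' s t := map_add ((stalkFunctor x).map f).hom s t
  map_smul' a s := by
    have germ {U : X.Opens} (hx : x ∈ U) (m : Γ(M, U)) :
        (stalkFunctor x).map f (M.presheaf.germ U x hx m) = N.presheaf.germ U x hx (f.app U m) :=
      TopCat.Presheaf.stalkFunctor_map_germ_apply U x hx f.mapPresheaf m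
    obtain ⟨U, hU, r, rfl⟩ := X.presheaf.exists_germ_eq a
    obtain ⟨V, hVU, hV, m, rfl⟩ := M.presheaf.exists_le_germ_eq s hU
    rw [← X.presheaf.germ_res_apply (homOfLE hVU) x hV r, ← germ_smul, germ,
      Scheme.Modules.Hom.app_smul, germ_smul, germ, RingHom.id_apply]

section stalkMap

variable {M N K : X.Modules} (f : M ⟶ N) (g : N ⟶ K)

lemma stalkMap_germ (x : X) (U : X.Opens) (hx : x ∈ U) (m : Γ(M, U)) :
    stalkMap f x (M.presheaf.germ U x hx m) = N.presheaf.germ U x hx (f.app U m) :=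
  TopCat.Presheaf.stalkFunctor_map_germ_apply U x hx f.mapPresheaf m

lemma stalkMap_stalkSpecializes {x y : X} (h : y ⤳ x) (s : M.presheaf.stalk x) :
    stalkMap f y (M.presheaf.stalkSpecializes h s) =
      N.presheaf.stalkSpecializes h (stalkMap f x s) := by
  obtain ⟨U, hU, m, rfl⟩ := M.presheaf.exists_germ_eq s
  simp only [stalkMap_germ, TopCat.Presheaf.germ_stalkSpecializes_apply]

lemma stalkMap_comp_apply (x : X) (s : M.presheaf.stalk x) :
    stalkMap (f ≫ g) x s = stalkMap g x (stalkMap f x s) :=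
  congr($((stalkFunctor x).map_comp f g) s)

lemma stalkMap_surjective [Epi f] (x : X) : Function.Surjective (stalkMap f x) :=
  (AddCommGrpCat.epi_iff_surjective ((stalkFunctor x).map f)).mp inferInstance

lemma stalkMap_injective [Mono f] (x : X) : Function.Injective (stalkMap f x) :=
  (AddCommGrpCat.mono_iff_injective ((stalkFunctor x).map f)).mp inferInstance

lemma isIso_of_stalkMap_bijective (h : ∀ x, Function.Bijective (stalkMap f x)) : IsIso f :=
  isIso_of_isIso_stalkFunctor_map f fun x ↦ (ConcreteCategory.isIso_iff_bijective _).mpr (h x)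

lemma exact_stalkMap {S : ShortComplex X.Modules} (hS : S.Exact) (x : X) :
    Function.Exact (stalkMap S.f x) (stalkMap S.g x) :=
  (ShortComplex.ab_exact_iff_function_exact _).mp (hS.map (stalkFunctor x))

lemma exact_stalkMap_cokernel (x : X) :
    Function.Exact (stalkMap f x) (stalkMap (cokernel.π f) x) :=
  exact_stalkMap (ShortComplex.exact_cokernel f) x

lemma exact_stalkMap_kernel (x : X) :
    Function.Exact (stalkMap (kernel.ι f) x) (stalkMap f x) :=
  exact_stalkMap (ShortComplex.exact_kernel f) x

end stalkMap

/-! ### Stalks of quasi-coherent modules as localizations -/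

lemma isLocalizing_of_isQuasicoherent {R : CommRingCat.{u}} (N : (Spec R).Modules)
    [N.IsQuasicoherent] : IsLocalizing (modulesSpecToSheaf.obj N) := by
  rw [← isIso_fromTildeΓ_iff_isLocalizing]; infer_instance

lemma exists_pow_smul_eq_map {R : CommRingCat.{u}} (N : (Spec R).Modules) [N.IsQuasicoherent]
    (r : R) (V : (Spec R).Opens) (hV : V = PrimeSpectrum.basicOpen r) (t : Γ(N, V)) :
    ∃ (n : ℕ) (m : Γ(N, ⊤)), r ^ n • t = N.presheaf.map V.leTop.op m := by
  subst hV
  obtain ⟨⟨m, ⟨_, n, rfl⟩⟩, hm⟩ := (isLocalizing_of_isQuasicoherent N r).surj t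
  exact ⟨n, m, hm⟩

lemma exists_pow_smul_eq_zero {R : CommRingCat.{u}} (N : (Spec R).Modules) [N.IsQuasicoherent]
    (r : R) (V : (Spec R).Opens) (hV : V = PrimeSpectrum.basicOpen r) (m : Γ(N, ⊤))
    (hm : N.presheaf.map V.leTop.op m = 0) : ∃ n : ℕ, r ^ n • m = 0 := by
  subst hV
  have := isLocalizing_of_isQuasicoherent N r
  obtain ⟨⟨_, n, rfl⟩, hn⟩ := (IsLocalizedModule.eq_zero_iff (.powers r)
    ((modulesSpecToSheaf.obj N).obj.map (PrimeSpectrum.basicOpen r).leTop.op).hom).mp hm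
  exact ⟨n, hn⟩

section

variable {R : CommRingCat.{u}} (f : Spec R ⟶ X) [IsOpenImmersion f]

/-- The section of `O_X` over the image of an open immersion `Spec R ⟶ X` given by `r : R`. -/
noncomputable def imageSection (r : R) : Γ(X, f ''ᵁ ⊤) :=
  (f.appIso ⊤).inv ((Scheme.ΓSpecIso R).inv r)

lemma isUnit_germ_imageSection (r : R) (z : Spec R) (hz : z ∈ PrimeSpectrum.basicOpen r)
    (hz' : f z ∈ f ''ᵁ ⊤) :
    IsUnit (X.presheaf.germ (f ''ᵁ ⊤) (f z) hz' (imageSection f r)) := by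
  refine (X.mem_basicOpen _ _ hz').mp ?_
  rw [imageSection, ← Scheme.image_basicOpen, basicOpen_eq_of_affine]
  exact ⟨z, hz, rfl⟩

lemma restrict_smul_eq (M : X.Modules) (V : (Spec R).Opens) (r : R) (t : Γ(M.restrict f, V)) :
    (M.restrictAppIso f V).hom (r • t) =
      X.presheaf.map (homOfLE (f.image_mono le_top) : f ''ᵁ V ⟶ f ''ᵁ ⊤).op (imageSection f r) •
        (M.restrictAppIso f V).hom t := by
  rw [Scheme.Modules.smul_Spec_def, imageSection, Scheme.Modules.smul_restrictAppIso_hom_apply]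
  congr 1
  exact congr($(Scheme.Hom.appIso_inv_naturality f (homOfLE le_top : V ⟶ ⊤).op).hom
    ((Scheme.ΓSpecIso R).inv r))

lemma restrictStalkNatIso_hom_germ (M : X.Modules) (V : (Spec R).Opens) (z : Spec R) (hz : z ∈ V)
    (hz' : f z ∈ f ''ᵁ V) (t : Γ(M.restrict f, V)) :
    (Scheme.Modules.restrictStalkNatIso f z).hom.app M ((M.restrict f).presheaf.germ V z hz t) =
      M.presheaf.germ (f ''ᵁ V) (f z) hz' ((M.restrictAppIso f V).hom t) :=
  congr($(Scheme.Modules.germ_restrictStalkNatIso_hom_app f z M hz) t)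

lemma mem_basicOpen_pow {z : Spec R} {r : R} (hr : z ∈ PrimeSpectrum.basicOpen r) (n : ℕ) :
    z ∈ PrimeSpectrum.basicOpen (r ^ n) :=
  fun h ↦ hr (z.isPrime.mem_of_pow_mem n h)

/-- A germ lives on some basic open `D(r)` containing `z`; a power of `r` clears its denominator and
is a unit at `z`. -/
lemma exists_smul_eq_germ_image (M : X.Modules) [M.IsQuasicoherent] (z : Spec R)
    (hz : f z ∈ f ''ᵁ ⊤) (s : M.presheaf.stalk (f z)) :
    ∃ (a : Γ(X, f ''ᵁ ⊤)) (m : Γ(M, f ''ᵁ ⊤)), IsUnit (X.presheaf.germ _ (f z) hz a) ∧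
      X.presheaf.germ _ (f z) hz a • s = M.presheaf.germ _ (f z) hz m := by
  let e := (Scheme.Modules.restrictStalkNatIso f z).app M
  obtain ⟨V, hzV, ⟨r, hr⟩, t, ht⟩ := (M.restrict f).presheaf.exists_mem_germ_eq_of_isBasis
    PrimeSpectrum.isBasis_basic_opens z (e.inv s)
  obtain ⟨n, m, hm⟩ := exists_pow_smul_eq_map _ r V hr.symm t
  refine ⟨imageSection f (r ^ n), (M.restrictAppIso f ⊤).hom m,
    isUnit_germ_imageSection f _ z (mem_basicOpen_pow (by rw [← hr] at hzV; exact hzV) n) _, ?_⟩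
  have hzV' : f z ∈ f ''ᵁ V := ⟨z, hzV, rfl⟩
  have hs : s = M.presheaf.germ (f ''ᵁ V) (f z) hzV' ((M.restrictAppIso f V).hom t) := by
    rw [← restrictStalkNatIso_hom_germ f M V z hzV, ht]
    exact (e.inv_hom_id_apply s).symm
  rw [hs, ← X.presheaf.germ_res_apply
    (homOfLE (f.image_mono le_top) : f ''ᵁ V ⟶ f ''ᵁ ⊤) (f z) hzV', ← germ_smul,
    ← restrict_smul_eq, hm]
  exact M.presheaf.germ_res_apply
    (homOfLE (f.image_mono le_top) : f ''ᵁ V ⟶ f ''ᵁ ⊤) (f z) hzV' _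

lemma exists_smul_eq_zero_image (M : X.Modules) [M.IsQuasicoherent] (z : Spec R)
    (hz : f z ∈ f ''ᵁ ⊤) (m : Γ(M, f ''ᵁ ⊤)) (hm : M.presheaf.germ _ (f z) hz m = 0) :
    ∃ a : Γ(X, f ''ᵁ ⊤), IsUnit (X.presheaf.germ _ (f z) hz a) ∧ a • m = 0 := by
  let e := (Scheme.Modules.restrictStalkNatIso f z).app M
  have h0 : (M.restrict f).presheaf.germ ⊤ z trivial m =
      (M.restrict f).presheaf.germ ⊤ z trivial 0 := by
    apply (ConcreteCategory.bijective_of_isIso e.hom).1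
    rw [map_zero]
    exact (restrictStalkNatIso_hom_germ f M ⊤ z trivial hz m).trans (hm.trans (map_zero _).symm)
  obtain ⟨V, hzV, ⟨r, hr⟩, _, _, h⟩ := (M.restrict f).presheaf.germ_eq_of_isBasis
    PrimeSpectrum.isBasis_basic_opens z _ _ h0
  obtain ⟨n, hn⟩ := exists_pow_smul_eq_zero (M.restrict f) r V hr.symm m (h.trans (map_zero _))
  refine ⟨imageSection f (r ^ n),
    isUnit_germ_imageSection f _ z (mem_basicOpen_pow (by rw [← hr] at hzV; exact hzV) n) _, ?_⟩
  have := restrict_smul_eq f M ⊤ (r ^ n) m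
  rw [hn, map_zero] at this
  refine Eq.trans ?_ this.symm
  congr 1
  exact congr($(X.presheaf.map_id _).hom (imageSection f (r ^ n))).symm

end

/-- Every point has a neighbourhood `U` such that the stalks of `M` at points of `U` are obtained
from `Γ(M, U)` by inverting sections of `O_X` over `U`. -/
lemma exists_open_forall_stalk (M : X.Modules) [M.IsQuasicoherent] (x : X) :
    ∃ U : X.Opens, x ∈ U ∧ ∀ y (hy : y ∈ U),
      (∀ s : M.presheaf.stalk y, ∃ (a : Γ(X, U)) (m : Γ(M, U)),
        IsUnit (X.presheaf.germ U y hy a) ∧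
          X.presheaf.germ U y hy a • s = M.presheaf.germ U y hy m) ∧
      (∀ m : Γ(M, U), M.presheaf.germ U y hy m = 0 →
        ∃ a : Γ(X, U), IsUnit (X.presheaf.germ U y hy a) ∧ a • m = 0) := by
  obtain ⟨R, f, hf, z₀, hz₀⟩ := Scheme.exists_Spec_apply_eq x
  refine ⟨f ''ᵁ ⊤, ⟨z₀, trivial, hz₀⟩, fun y hy ↦ ?_⟩
  obtain ⟨z, -, rfl⟩ := id hy
  exact ⟨exists_smul_eq_germ_image f M z hy, exists_smul_eq_zero_image f M z hy⟩

/-! ### Localization along a generization -/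

section Specialization

variable (M : X.Modules) {x y : X} (h : y ⤳ x)

lemma exists_smul_eq_zero_of_stalkSpecializes_eq_zero [M.IsQuasicoherent]
    (s : M.presheaf.stalk x) (hs : M.presheaf.stalkSpecializes h s = 0) :
    ∃ r : X.presheaf.stalk x, IsUnit (X.presheaf.stalkSpecializes h r) ∧ r • s = 0 := by
  obtain ⟨U, hxU, hU⟩ := exists_open_forall_stalk M x
  have hyU : y ∈ U := h.mem_open U.2 hxU
  obtain ⟨a, m, ha, ham⟩ := (hU x hxU).1 s
  obtain ⟨b, hb, hbm⟩ := (hU y hyU).2 m (by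
    rw [← TopCat.Presheaf.germ_stalkSpecializes_apply _ hxU h, ← ham, stalkSpecializes_smul, hs,
      smul_zero])
  refine ⟨X.presheaf.germ U x hxU b * X.presheaf.germ U x hxU a, ?_, ?_⟩
  · rw [map_mul, TopCat.Presheaf.germ_stalkSpecializes_apply]
    exact hb.mul (ha.map (X.presheaf.stalkSpecializes h).hom)
  · rw [mul_smul, ham, ← germ_smul, hbm, map_zero]

lemma exists_smul_eq_stalkSpecializes [M.IsQuasicoherent] (s : M.presheaf.stalk y) :
    ∃ (r : X.presheaf.stalk x) (t : M.presheaf.stalk x),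
      IsUnit (X.presheaf.stalkSpecializes h r) ∧
        X.presheaf.stalkSpecializes h r • s = M.presheaf.stalkSpecializes h t := by
  obtain ⟨U, hxU, hU⟩ := exists_open_forall_stalk M x
  have hyU : y ∈ U := h.mem_open U.2 hxU
  obtain ⟨a, m, ha, ham⟩ := (hU y hyU).1 s
  refine ⟨X.presheaf.germ U x hxU a, M.presheaf.germ U x hxU m, ?_⟩
  simp only [TopCat.Presheaf.germ_stalkSpecializes_apply]
  exact ⟨ha, ham⟩

end Specialization

/-- The property of quasi-coherent modules that sections vanishing at a generization are killed
by functions invertible there passes to cokernels. -/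
lemma exists_smul_eq_zero_of_cokernel {M N : X.Modules} [M.IsQuasicoherent] [N.IsQuasicoherent]
    (f : M ⟶ N) {x y : X} (h : y ⤳ x) (s : (cokernel f).presheaf.stalk x)
    (hs : (cokernel f).presheaf.stalkSpecializes h s = 0) :
    ∃ r : X.presheaf.stalk x, IsUnit (X.presheaf.stalkSpecializes h r) ∧ r • s = 0 := by
  obtain ⟨n, rfl⟩ := stalkMap_surjective (cokernel.π f) x s
  rw [← stalkMap_stalkSpecializes] at hs
  obtain ⟨m', hm'⟩ := (exact_stalkMap_cokernel f y _).mp hs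
  obtain ⟨r, m, hr, hrm⟩ := exists_smul_eq_stalkSpecializes M h m'
  -- Vanishing at `y` in the cokernel means coming from `M` there; once `r` has cleared
  -- denominators, the discrepancy at `x` dies at `y`, so it is killed by a further unit at `y`.
  obtain ⟨r', hr', hr'n⟩ := exists_smul_eq_zero_of_stalkSpecializes_eq_zero N h
    (r • n - stalkMap f x m) (by
      rw [map_sub, stalkSpecializes_smul, ← hm', ← stalkMap_stalkSpecializes, ← hrm, map_smul,
        sub_self])
  refine ⟨r' * r, by rw [map_mul]; exact hr'.mul hr, ?_⟩
  rw [smul_sub, sub_eq_zero] at hr'n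
  rw [mul_smul, ← map_smul, ← map_smul, hr'n, map_smul,
    (exact_stalkMap_cokernel f x _).mpr ⟨m, rfl⟩, smul_zero]

/-! ### Associated points detect nonzero germs -/

lemma exists_mul_eq_stalkSpecializes {x y : X} (h : y ⤳ x) (a : X.presheaf.stalk y) :
    ∃ r t : X.presheaf.stalk x, IsUnit (X.presheaf.stalkSpecializes h r) ∧
      X.presheaf.stalkSpecializes h r * a = X.presheaf.stalkSpecializes h t := by
  obtain ⟨_, ⟨U, hU, rfl⟩, hxU, -⟩ :=
    X.isBasis_affineOpens.exists_subset_of_mem_open (Set.mem_univ x) isOpen_univ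
  have hyU : y ∈ U := h.mem_open U.2 hxU
  let := TopCat.Presheaf.algebra_section_stalk X.presheaf (⟨y, hyU⟩ : U)
  have := hU.isLocalization_stalk ⟨y, hyU⟩
  obtain ⟨⟨t, r⟩, hrt⟩ := IsLocalization.surj
    (hU.primeIdealOf ⟨y, hyU⟩).asIdeal.primeCompl (S := X.presheaf.stalk y) a
  refine ⟨X.presheaf.germ U x hxU r, X.presheaf.germ U x hxU t, ?_⟩
  simp only [TopCat.Presheaf.germ_stalkSpecializes_apply]
  exact ⟨IsLocalization.map_units (X.presheaf.stalk y) r, (mul_comm _ _).trans hrt⟩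

/-- Every prime of `O_{X,x}` comes from a generization of `x`. -/
lemma exists_specializes_comap_maximalIdeal_eq (x : X) (P : Ideal (X.presheaf.stalk x))
    [hP : P.IsPrime] : ∃ (y : X) (h : y ⤳ x), ∀ r : X.presheaf.stalk x,
      r ∈ P ↔ ¬ IsUnit (X.presheaf.stalkSpecializes h r) := by
  let z : Spec (X.presheaf.stalk x) := ⟨P, hP⟩
  have h : X.fromSpecStalk x z ⤳ x := by
    have : X.fromSpecStalk x z ∈ Set.range (X.fromSpecStalk x) := ⟨z, rfl⟩
    rwa [Scheme.range_fromSpecStalk] at this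
  refine ⟨_, h, fun r ↦ ?_⟩
  let c : Spec (X.presheaf.stalk (X.fromSpecStalk x z)) := IsLocalRing.closedPoint _
  have hz : z = Spec.map (X.presheaf.stalkSpecializes h) c := by
    apply (X.fromSpecStalk x).isEmbedding.injective
    rw [← Scheme.Hom.comp_apply, Scheme.SpecMap_stalkSpecializes_fromSpecStalk,
      Scheme.fromSpecStalk_closedPoint]
  have hP : P = (Spec.map (X.presheaf.stalkSpecializes h) c).asIdeal :=
    congr(PrimeSpectrum.asIdeal $hz)
  exact SetLike.ext_iff.mp hP r

/-- The annihilator of `s` lies in an associated prime `P` of the stalk, and `P` corresponds to the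
generization `y`. The hypothesis `hQ` replaces quasi-coherence of `Q`, so that cokernels can be used
directly. -/
lemma exists_mem_associatedPoints [IsLocallyNoetherian X] (Q : X.Modules) {x : X}
    (hQ : ∀ (y : X) (h : y ⤳ x) (s : Q.presheaf.stalk x), Q.presheaf.stalkSpecializes h s = 0 →
      ∃ r : X.presheaf.stalk x, IsUnit (X.presheaf.stalkSpecializes h r) ∧ r • s = 0)
    (s : Q.presheaf.stalk x) (hs : s ≠ 0) :
    ∃ (y : X) (h : y ⤳ x), y ∈ associatedPoints Q ∧ Q.presheaf.stalkSpecializes h s ≠ 0 := by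
  obtain ⟨P, hP, hsP⟩ :=
    exists_le_isAssociatedPrime_of_isNoetherianRing (X.presheaf.stalk x) s hs
  obtain ⟨hP, t, ht⟩ := isAssociatedPrime_iff.mp hP
  have ht (r : X.presheaf.stalk x) : r ∈ P ↔ r • t = 0 := by
    rw [ht, Submodule.mem_colon_singleton, Submodule.mem_bot]
  obtain ⟨y, h, hy⟩ := exists_specializes_comap_maximalIdeal_eq x P
  refine ⟨y, h, ⟨Q.presheaf.stalkSpecializes h t, fun a ↦ ?_⟩, fun h0 ↦ ?_⟩
  · obtain ⟨r, b, hr, hra⟩ := exists_mul_eq_stalkSpecializes h a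
    -- As `r` is a unit at `y` and `r * a` is the image of `b`, both sides become conditions on `b`:
    -- killing `t` at `y`, and lying in `P`.
    rw [← hr.smul_eq_zero, ← mul_smul, hra, ← stalkSpecializes_smul,
      IsLocalRing.mem_maximalIdeal, mem_nonunits_iff, ← (IsUnit.mul_iff.trans (and_iff_right hr)), hra, ← hy, ht]
    refine ⟨fun h0 ↦ ?_, fun h0 ↦ by rw [h0, map_zero]⟩
    obtain ⟨c, hc, hcb⟩ := hQ y h _ h0
    rw [← mul_smul, ← ht] at hcb
    rw [← ht]
    exact (hP.mem_or_mem hcb).resolve_left fun hcP ↦ (hy c).mp hcP hc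
  · obtain ⟨r, hr, hrs⟩ := hQ y h s h0
    exact (hy r).mp (hsP (by rwa [Submodule.mem_colon_singleton, Submodule.mem_bot])) hr

/-- Cokernels of morphisms of quasi-coherent modules with a single associated point `p` have
stalks that inject into the stalk at `p`. -/
lemma stalkSpecializes_ne_zero_of_associatedPoints_eq [IsLocallyNoetherian X] {M N : X.Modules}
    [M.IsQuasicoherent] [N.IsQuasicoherent] (f : M ⟶ N) {p : X}
    (hp : associatedPoints (cokernel f) = {p}) {x : X} (s : (cokernel f).presheaf.stalk x)
    (hs : s ≠ 0) : ∃ h : p ⤳ x, (cokernel f).presheaf.stalkSpecializes h s ≠ 0 := by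
  obtain ⟨y, h, hy, hys⟩ := exists_mem_associatedPoints (cokernel f)
    (fun y h s ↦ exists_smul_eq_zero_of_cokernel f h s) s hs
  rw [hp, Set.mem_singleton_iff] at hy
  subst hy
  exact ⟨h, hys⟩

/-! ### Stalks of subobjects and of their quotients -/

section stalkSubmodule

variable {F : X.Modules}

/-- The stalk of a subobject of `F`, as a submodule of the stalk of `F`. -/
noncomputable def stalkSubmodule (a : Subobject F) (x : X) :
    Submodule (X.presheaf.stalk x) (F.presheaf.stalk x) :=
  LinearMap.range (stalkMap a.arrow x)

lemma stalkMap_ofLE_arrow {a b : Subobject F} (h : a ≤ b) (x : X)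
    (s : (a : X.Modules).presheaf.stalk x) :
    stalkMap b.arrow x (stalkMap (a.ofLE b h) x s) = stalkMap a.arrow x s := by
  rw [← stalkMap_comp_apply, Subobject.ofLE_arrow]

lemma stalkSubmodule_mono {a b : Subobject F} (h : a ≤ b) (x : X) :
    stalkSubmodule a x ≤ stalkSubmodule b x := by
  rintro _ ⟨s, rfl⟩
  exact ⟨_, stalkMap_ofLE_arrow h x s⟩

lemma stalkSubmodule_bot (x : X) : stalkSubmodule (⊥ : Subobject F) x = ⊥ := by
  rw [eq_bot_iff]
  rintro _ ⟨s, rfl⟩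
  obtain ⟨U, hU, m, rfl⟩ := Scheme.Modules.presheaf _ |>.exists_germ_eq s
  rw [Subobject.bot_arrow, stalkMap_germ]
  exact map_zero _

lemma stalkSubmodule_top (x : X) : stalkSubmodule (⊤ : Subobject F) x = ⊤ :=
  LinearMap.range_eq_top.mpr (stalkMap_surjective _ x)

/-- The kernel of `a ⟶ F/b` lies in `a ⊓ b`, and its stalks are computed by exactness. -/
lemma le_stalkSubmodule_inf (a b : Subobject F) (x : X) :
    stalkSubmodule a x ⊓ stalkSubmodule b x ≤ stalkSubmodule (a ⊓ b) x := by
  rintro _ ⟨⟨s, rfl⟩, t, ht⟩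
  let g : (a : X.Modules) ⟶ cokernel b.arrow := a.arrow ≫ cokernel.π b.arrow
  obtain ⟨u, rfl⟩ := (exact_stalkMap_kernel g x s).mp (by
    rw [stalkMap_comp_apply, ← ht]
    exact (exact_stalkMap_cokernel b.arrow x _).mpr ⟨t, rfl⟩)
  have hle : Subobject.mk (kernel.ι g ≫ a.arrow) ≤ a ⊓ b := by
    refine le_inf (Subobject.mk_le_of_comm (kernel.ι g) rfl)
      (Subobject.mk_le_of_comm (Abelian.monoLift b.arrow (kernel.ι g ≫ a.arrow) ?_)
        (Abelian.monoLift_comp _ _ _))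
    rw [Category.assoc, kernel.condition]
  refine stalkSubmodule_mono hle x
    ⟨stalkMap (Subobject.underlyingIso (kernel.ι g ≫ a.arrow)).inv x u, ?_⟩
  rw [← stalkMap_comp_apply, Subobject.underlyingIso_arrow, stalkMap_comp_apply]

lemma stalkSubmodule_inf (a b : Subobject F) (x : X) :
    stalkSubmodule (a ⊓ b) x = stalkSubmodule a x ⊓ stalkSubmodule b x :=
  le_antisymm (le_inf (stalkSubmodule_mono inf_le_left x) (stalkSubmodule_mono inf_le_right x))
    (le_stalkSubmodule_inf a b x)

lemma stalkMap_cokernel_π_ofLE_eq_zero_iff {a b : Subobject F} (h : a ≤ b) (x : X)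
    (s : (b : X.Modules).presheaf.stalk x) :
    stalkMap (cokernel.π (a.ofLE b h)) x s = 0 ↔
      stalkMap b.arrow x s ∈ stalkSubmodule a x := by
  rw [exact_stalkMap_cokernel (a.ofLE b h) x s]
  constructor
  · rintro ⟨t, rfl⟩
    exact ⟨t, (stalkMap_ofLE_arrow h x t).symm⟩
  · rintro ⟨t, ht⟩
    exact ⟨t, stalkMap_injective b.arrow x ((stalkMap_ofLE_arrow h x t).trans ht)⟩

/-- At each stalk, either both pairs of submodules agree or both quotients vanish; the choice may
depend on the point. -/
lemma nonempty_cokernel_iso {a₀ a₁ m₀ m₁ : Subobject F} (ha : a₀ ≤ a₁) (hm : m₀ ≤ m₁)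
    (h₀ : m₀ ≤ a₀) (h₁ : m₁ ≤ a₁)
    (h : ∀ x, stalkSubmodule a₁ x ≤ stalkSubmodule m₁ x ∧
        stalkSubmodule a₀ x ≤ stalkSubmodule m₀ x ∨
      stalkSubmodule a₁ x ≤ stalkSubmodule a₀ x ∧ stalkSubmodule m₁ x ≤ stalkSubmodule m₀ x) :
    Nonempty (cokernel (m₀.ofLE m₁ hm) ≅ cokernel (a₀.ofLE a₁ ha)) := by
  let φ : cokernel (m₀.ofLE m₁ hm) ⟶ cokernel (a₀.ofLE a₁ ha) :=
    cokernel.map _ _ (m₀.ofLE a₀ h₀) (m₁.ofLE a₁ h₁) (by simp)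
  have hφ (x : X) (s : (m₁ : X.Modules).presheaf.stalk x) :
      stalkMap φ x (stalkMap (cokernel.π (m₀.ofLE m₁ hm)) x s) =
        stalkMap (cokernel.π (a₀.ofLE a₁ ha)) x (stalkMap (m₁.ofLE a₁ h₁) x s) := by
    rw [← stalkMap_comp_apply, ← stalkMap_comp_apply, cokernel.π_desc]
  suffices IsIso φ from ⟨asIso φ⟩
  refine isIso_of_stalkMap_bijective φ fun x ↦ ⟨?_, fun q ↦ ?_⟩
  · rw [injective_iff_map_eq_zero]
    intro q hq
    obtain ⟨s, rfl⟩ := stalkMap_surjective (cokernel.π (m₀.ofLE m₁ hm)) x q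
    rw [hφ, stalkMap_cokernel_π_ofLE_eq_zero_iff, stalkMap_ofLE_arrow] at hq
    rw [stalkMap_cokernel_π_ofLE_eq_zero_iff]
    rcases h x with ⟨-, h⟩ | ⟨-, h⟩
    exacts [h hq, h ⟨s, rfl⟩]
  · obtain ⟨s, rfl⟩ := stalkMap_surjective (cokernel.π (a₀.ofLE a₁ ha)) x q
    rcases h x with ⟨h, -⟩ | ⟨h, -⟩
    · obtain ⟨t, ht⟩ := h ⟨s, rfl⟩
      refine ⟨stalkMap (cokernel.π (m₀.ofLE m₁ hm)) x t, ?_⟩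
      rw [hφ]
      congr 1
      exact stalkMap_injective a₁.arrow x ((stalkMap_ofLE_arrow h₁ x t).trans ht)
    · refine ⟨0, ?_⟩
      rw [map_zero, eq_comm, stalkMap_cokernel_π_ofLE_eq_zero_iff]
      exact h ⟨s, rfl⟩

end stalkSubmodule

variable {F : X.Modules}

lemma stalkSpecializes_mem_stalkSubmodule (a : Subobject F) {x y : X} (h : y ⤳ x)
    {t : F.presheaf.stalk x} (ht : t ∈ stalkSubmodule a x) :
    F.presheaf.stalkSpecializes h t ∈ stalkSubmodule a y := by
  obtain ⟨s, rfl⟩ := ht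
  exact ⟨_, stalkMap_stalkSpecializes a.arrow h s⟩

/-! ### Comparison of two coprimary filtrations -/

namespace CoprimaryFiltration

variable (A B : CoprimaryFiltration F)

lemma sub_monotone : Monotone A.sub := Fin.monotone_iff_le_succ.mpr A.sub_le

/-- Distinct points have distinct closures since a scheme is T0, so a specialization between them is
a strict inclusion of closures. -/
lemma le_of_point_specializes {i k : Fin A.n} (h : A.point k ⤳ A.point i) : i ≤ k := by
  by_contra! hlt
  refine hlt.not_gt (A.lt_of_closure_ssubset i k ?_)
  refine ssubset_of_subset_not_subset h.closure_subset fun hle ↦ hlt.ne' (A.point_injective ?_)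
  exact (specializes_iff_closure_subset.mpr hle).antisymm h |>.eq

/-- Locates the step of the filtration at which the germ `t` enters. -/
lemma exists_mem_succ_notMem_castSucc {x : X} {t : F.presheaf.stalk x} {a b : Fin (A.n + 1)}
    (ha : t ∉ stalkSubmodule (A.sub a) x) (hb : t ∈ stalkSubmodule (A.sub b) x) :
    ∃ k : Fin A.n, a ≤ k.castSucc ∧ k.succ ≤ b ∧ t ∈ stalkSubmodule (A.sub k.succ) x ∧
      t ∉ stalkSubmodule (A.sub k.castSucc) x := by
  induction b using Fin.induction with
  | zero => exact (ha (stalkSubmodule_mono (A.sub_monotone (Fin.zero_le a)) x hb)).elim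
  | succ k ih =>
    by_cases hk : t ∈ stalkSubmodule (A.sub k.castSucc) x
    · obtain ⟨l, h₁, h₂, h⟩ := ih hk
      exact ⟨l, h₁, h₂.trans k.castSucc_lt_succ.le, h⟩
    · refine ⟨k, ?_, le_rfl, hb, hk⟩
      by_contra! h
      exact ha (stalkSubmodule_mono (A.sub_monotone (Fin.castSucc_lt_iff_succ_le.mp h)) x hb)

variable [IsLocallyNoetherian X]

lemma exists_point_specializes {x : X} {t : F.presheaf.stalk x} {k : Fin A.n}
    (hs : t ∈ stalkSubmodule (A.sub k.succ) x) (hc : t ∉ stalkSubmodule (A.sub k.castSucc) x) :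
    ∃ h : A.point k ⤳ x,
      F.presheaf.stalkSpecializes h t ∉ stalkSubmodule (A.sub k.castSucc) (A.point k) := by
  obtain ⟨s, rfl⟩ := hs
  have := (A.sub_isCoherent k.castSucc).isQuasicoherent
  have := (A.sub_isCoherent k.succ).isQuasicoherent
  obtain ⟨h, hne⟩ := stalkSpecializes_ne_zero_of_associatedPoints_eq _
    (A.associatedPoints_quotient k) (stalkMap (cokernel.π _) x s)
    (mt (stalkMap_cokernel_π_ofLE_eq_zero_iff (A.sub_le k) x s).mp hc)
  refine ⟨h, fun hmem ↦ hne ?_⟩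
  rw [← stalkMap_stalkSpecializes] at hmem ⊢
  exact (stalkMap_cokernel_π_ofLE_eq_zero_iff (A.sub_le k) _ _).mpr hmem

lemma exists_point_specializes_of_ne_zero {x : X} {t : F.presheaf.stalk x} {b : Fin (A.n + 1)}
    (hb : t ∈ stalkSubmodule (A.sub b) x) (ht : t ≠ 0) :
    ∃ k : Fin A.n, k.succ ≤ b ∧ A.point k ⤳ x := by
  obtain ⟨k, -, hkb, hk, hk'⟩ := A.exists_mem_succ_notMem_castSucc (a := 0)
    (by rwa [A.sub_zero, stalkSubmodule_bot, Submodule.mem_bot]) hb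
  exact ⟨k, hkb, (A.exists_point_specializes hk hk').1⟩

lemma stalkSubmodule_succ_le {x : X} {k : Fin A.n} (h : ¬ A.point k ⤳ x) :
    stalkSubmodule (A.sub k.succ) x ≤ stalkSubmodule (A.sub k.castSucc) x :=
  fun _ ht ↦ by_contra fun ht' ↦ h (A.exists_point_specializes ht ht').1

variable {A B}

lemma stalkSubmodule_castSucc_inf_succ_le {i : Fin A.n} {j : Fin B.n}
    (hij : A.point i = B.point j) (x : X) :
    stalkSubmodule (A.sub i.castSucc) x ⊓ stalkSubmodule (B.sub j.succ) x ≤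
      stalkSubmodule (B.sub j.castSucc) x := by
  rintro t ⟨hA, hB⟩
  by_contra hB'
  obtain ⟨h, hne⟩ := B.exists_point_specializes hB hB'
  obtain ⟨k, hki, hk⟩ := A.exists_point_specializes_of_ne_zero
    (stalkSpecializes_mem_stalkSubmodule _ h hA) (ne_of_mem_of_not_mem (zero_mem _) hne).symm
  rw [← hij] at hk
  exact (A.le_of_point_specializes hk).not_gt (Fin.succ_le_castSucc_iff.mp hki)

lemma stalkSubmodule_succ_le_succ
    (hdisj : ∀ p ∈ associatedPoints F, ∀ q ∈ associatedPoints F,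
      p ∉ closure {q} → q ∉ closure {p} → closure {p} ∩ closure {q} = ∅)
    {i : Fin A.n} {j : Fin B.n} (hij : A.point i = B.point j) {x : X} (hx : A.point i ⤳ x) :
    stalkSubmodule (A.sub i.succ) x ≤ stalkSubmodule (B.sub j.succ) x := by
  intro t hA
  by_contra hB
  obtain ⟨l, hjl, -, hl, hl'⟩ := B.exists_mem_succ_notMem_castSucc (b := Fin.last B.n) hB
    (by rw [B.sub_last, stalkSubmodule_top]; trivial)
  replace hjl : j < l := Fin.succ_le_castSucc_iff.mp hjl
  obtain ⟨h, hne⟩ := B.exists_point_specializes hl hl'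
  obtain ⟨k, hki, hk⟩ := A.exists_point_specializes_of_ne_zero
    (stalkSpecializes_mem_stalkSubmodule _ h hA) (ne_of_mem_of_not_mem (zero_mem _) hne).symm
  have hpq : ¬ A.point i ⤳ B.point l := fun h ↦
    (B.le_of_point_specializes (hij ▸ h)).not_gt hjl
  -- Otherwise `A.point k ⤳ A.point i`, so `k = i`, and `hk` becomes the specialization that `hpq`
  -- excludes.
  have hqp : ¬ B.point l ⤳ A.point i := fun h ↦
    hpq ((Fin.succ_le_succ_iff.mp hki).antisymm (A.le_of_point_specializes (hk.trans h)) ▸ hk)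
  refine (hdisj (A.point i) (A.range_point ▸ ⟨i, rfl⟩) (B.point l) (B.range_point ▸ ⟨l, rfl⟩)
    (mt specializes_iff_mem_closure.mpr hqp) (mt specializes_iff_mem_closure.mpr hpq)).le
    ⟨hx.mem_closure, h.mem_closure⟩

/-- Here `m₀` and `m₁` are variables with equations so that, up to `inf_comm`, one and the same
quotient serves for both filtrations. -/
lemma nonempty_inf_iso
    (hdisj : ∀ p ∈ associatedPoints F, ∀ q ∈ associatedPoints F,
      p ∉ closure {q} → q ∉ closure {p} → closure {p} ∩ closure {q} = ∅)
    {i : Fin A.n} {j : Fin B.n} (hij : A.point i = B.point j) {m₀ m₁ : Subobject F} (hm : m₀ ≤ m₁)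
    (h₀ : m₀ = A.sub i.castSucc ⊓ B.sub j.castSucc) (h₁ : m₁ = A.sub i.succ ⊓ B.sub j.succ) :
    Nonempty (cokernel (m₀.ofLE m₁ hm) ≅ A.subquotient i) := by
  subst h₀ h₁
  refine nonempty_cokernel_iso _ _ inf_le_left inf_le_left fun x ↦ ?_
  simp only [stalkSubmodule_inf]
  by_cases hx : A.point i ⤳ x
  · have h := stalkSubmodule_succ_le_succ hdisj hij hx
    exact .inl ⟨le_inf le_rfl h, le_inf le_rfl ((le_inf le_rfl
      ((stalkSubmodule_mono (A.sub_le i) x).trans h)).trans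
        (stalkSubmodule_castSucc_inf_succ_le hij x))⟩
  · have h := A.stalkSubmodule_succ_le hx
    exact .inr ⟨h, inf_le_inf h (B.stalkSubmodule_succ_le (hij ▸ hx))⟩

end CoprimaryFiltration

end CoprimaryFiltrations

theorem theorem4p6 {X : Scheme.{u}} [AlgebraicGeometry.IsNoetherian X] (F : X.Modules)
    (hF : CoprimaryFiltrations.IsCoherent F) (hF0 : ¬ IsZero F)
    (hdisj : ∀ p ∈ CoprimaryFiltrations.associatedPoints F,
      ∀ q ∈ CoprimaryFiltrations.associatedPoints F,
        p ∉ closure {q} → q ∉ closure {p} → closure {p} ∩ closure {q} = ∅)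
    (A B : CoprimaryFiltrations.CoprimaryFiltration F) :
    A.Equivalent B := by
  intro i j h
  have hij : A.point i = B.point j := Set.singleton_injective
    ((A.associatedPoints_quotient i).symm.trans (h.trans (B.associatedPoints_quotient j)))
  have hm := inf_le_inf (A.sub_le i) (B.sub_le j)
  obtain ⟨e⟩ := CoprimaryFiltrations.CoprimaryFiltration.nonempty_inf_iso hdisj hij hm rfl rfl
  obtain ⟨e'⟩ := CoprimaryFiltrations.CoprimaryFiltration.nonempty_inf_iso hdisj hij.symm hm
    (inf_comm _ _) (inf_comm _ _)
  exact ⟨e.symm ≪≫ e'⟩
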